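/- **Setting.** Let $X,Y$ be real locally convex Hausdorff topological vector spaces, $Z$ a real normed space, $\mathcal U$ a nonempty compact topological space. Let $K\subsetneq Y$ be a closed convex cone with $\operatorname{int}K\neq\emptyset$ and $S\subset Z$ a nonempty closed convex cone. Put $Y^\bullet=Y\cup\{\pm\infty_Y\}$, $Z^\bullet=Z\cup\{\pm\infty_Z\}$. Let $\emptyset\ne C\subset X$, and let $F:X\to Y^\bullet$ and $G_u:X\to Z^\bullet$ ($u\in\mathcal U$) be proper, i.e. never $-\infty$ and with nonempty domain ($\operatorname{dom}F=\{x:F(x)\neq+\infty_Y\}$). Let $A=C\cap\bigcap_{u}G_u^{-1}(-S)$ and assume $A\cap\operatorname{dom}F\ne\emptyset$. **Notation.** $Z^*$ is the topological dual with the weak* topology, and $S^+=\{z^*\in Z^*: z^*(s)\ge 0\ \forall s\in S\}$; $K^+\subset Y^*$ likewise. $\mathcal L(X,Y)$ is the space of continuous linear maps with the topology of pointwise convergence, and $\mathcal L(X,Y)\times Y$ has the product topology. For $T\in\mathcal L(Z,Y)$ and $z^*\in Z^*$, $T\circ G_u$ and $z^*\circ G_u$ take the value $+\infty$ where $G_u=+\infty_Z$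 (also for $z^*=0$, $T=0$). $I_D$ is $0_Y$ on $D$ and $+\infty_Y$ off $D$. For $k\in Y$, $(k\cdot z^*)(z)=z^*(z)k$, and similarly for $x^*\in X^*$. On $Y^\bullet$ write $y_1<_Ky_2$ if $y_1-y_2\in-\operatorname{int}K$ (for $y_1,y_2\in Y$), with $-\infty_Y$ below and $+\infty_Y$ above all other elements. For $M\subset Y^\bullet$, $\operatorname{WSup}M$ is the set of all $\bar v\in Y^\bullet$ such that $\bar v\not<_Kv$ for all $v\in M$, and for every $\tilde v<_K\bar v$ there is $v\in M$ with $\tilde v<_Kv$. The conjugate of a mapping $H:X\to Y^\bullet$ is $H^*(L)=\operatorname{WSup}\{L(x)-H(x):x\in X\}$, $L\in\mathcal L(X,Y)$ (likewise with $Z$ in place of $X$), and $\operatorname{epi}H^*=\{(L,y)\in\mathcal L(X,Y)\times Y:y\in H^*(L)+K\}$. Let $\mathcal L_+(S,K)=\{T\in\mathcal L(Z,Y):T(S)\subset K\}$, $\mathcal L_+^w(S,K)=\{T\in\mathcal L(Z,Y):T(S)\cap(-\operatorname{int}K)=\emptyset\}$ and $$\mathcal A=\bigcup_{(T,u)\in\mathcal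 L_+(S,K)\times\mathcal U}\operatorname{epi}(F+I_C+T\circ G_u)^*,\qquad \mathcal A_k=\bigcup_{(z^*,u)\in S^+\times\mathcal U}\operatorname{epi}(F+I_C+(k\cdot z^*)\circ G_u)^*\quad(k\in\operatorname{int}K),$$ $$\mathcal B=\bigcup_{(T,u)\in\mathcal L^w_+(S,K)\times\mathcal U}\ \bigcap_{v\in I^*_{-S}(T)}\big[\operatorname{epi}(F+I_C+T\circ G_u)^*+(0,v)\big].$$ A set $N\subset\mathcal L(X,Y)\times Y$ is $k$-sectionally convex if $N\cap(E_k+w)$ is convex for every $w\in\mathcal L(X,Y)\times Y$, where $E_k=\{(k\cdot x^*,rk):x^*\in X^*,\ r\in\mathbb R\}$. **Hypotheses.** - $(\mathcal H_0)$ $\{(x,y)\in X\times Y:y\in F(x)+K\}$ is convex; $y^*\circ F$ is lower semicontinuous for all $y^*\in K^+\setminus\{0\}$ (with $y^*(+\infty_Y)=+\infty$); for each $u$, $\{(x,z)\in X\times Z:z\in G_u(x)+S\}$ is convex and closed; $C$ is nonempty, closed and convex. - $(\mathcal H_1)$ For all $z_1^*,z_2^*\in S^+$ and $u_1,u_2\in\mathcal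 U$ there are $z^*\in S^+$ and $u\in\mathcal U$ such that $(z_1^*\circ G_{u_1})(x)+(z_2^*\circ G_{u_2})(x)\le(z^*\circ G_u)(x)$ for all $x\in C\cap\operatorname{dom}F$. - $(\mathcal H_2)$ For each $x\in C\cap\operatorname{dom}F$ and all nets $(z^*_\alpha,u_\alpha,r_\alpha)$ in $S^+\times\mathcal U\times\mathbb R$ with $(z_\alpha^*\circ G_{u_\alpha})(x)\ge r_\alpha$ for all $\alpha$ and $z^*_\alpha\to z^*\in S^+$ weak*, $u_\alpha\to u$ in $\mathcal U$, $r_\alpha\to r$ in $\mathbb R$, one has $(z^*\circ G_u)(x)\ge r$. - $(C_0)$ For each $u\in\mathcal U$ there is $x_u\in C\cap\operatorname{dom}F$ with $G_u(x_u)\in-\operatorname{int}S$. **Proposition.** Under these hypotheses, for every $k\in\operatorname{int}K$ the sets $\mathcal A_k$, $\mathcal A$ and $\mathcal B$ are $k$-sectionally convex and closed in $\mathcal L(X,Y)\times Y$. Moreover $\mathcal A_k=\mathcal A=\mathcal B=\operatorname{epi}(F+I_A)^*$. -/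

import Mathlib

open Set Topology Filter

namespace RobustVO

universe uX uY uZ uU uV uι

/-! ### The extended space `V ∪ {-∞_V, +∞_V}` -/

/-- The space `V` with a smallest element `bot = -∞_V` and a greatest element `top = +∞_V`. -/
inductive ExtSpace (V : Type uV) : Type uV
  | bot : ExtSpace V
  | fin : V → ExtSpace V
  | top : ExtSpace V

namespace ExtSpace

section
variable {V : Type uV} {W : Type uZ}

/-- `-(+∞) = -∞` and `-(-∞) = +∞`. -/
def neg [Neg V] : ExtSpace V → ExtSpace V
  | bot => top
  | fin v => fin (-v)
  | top => bot

instance [Neg V] : Neg (ExtSpace V) := ⟨ExtSpace.neg⟩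

/-- Addition on the extended space. The two sums `(-∞) + (+∞)` and `(+∞) + (-∞)` are never
considered in the theory; here they get the (irrelevant) value `-∞`. -/
def add [Add V] : ExtSpace V → ExtSpace V → ExtSpace V
  | bot, _ => bot
  | _, bot => bot
  | top, _ => top
  | _, top => top
  | fin v, fin w => fin (v + w)

instance [Add V] : Add (ExtSpace V) := ⟨ExtSpace.add⟩

/-- Extension of a map `V → W` by `±∞_V ↦ ±∞_W`. -/
def map (f : V → W) : ExtSpace V → ExtSpace W
  | bot => bot
  | fin v => fin (f v)
  | top => top

/-- The weak ordering `<_K`: `y₁ <_K y₂` iff `y₁ - y₂ ∈ - int K` for `y₁, y₂ ∈ V`, while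
`-∞` is below and `+∞` above every other element. -/
def WLT [AddCommGroup V] [TopologicalSpace V] (K : Set V) : ExtSpace V → ExtSpace V → Prop
  | bot, bot => False
  | bot, _ => True
  | fin _, bot => False
  | fin y₁, fin y₂ => y₁ - y₂ ∈ -interior K
  | fin _, top => True
  | top, _ => False

/-- The weak supremum of a set `M` of extended elements (it is `{-∞}` for `M = ∅`). -/
def wsup [AddCommGroup V] [TopologicalSpace V] (K : Set V) (M : Set (ExtSpace V)) : Set (ExtSpace V) :=
  {w | (∀ v ∈ M, ¬ WLT K w v) ∧ ∀ w', WLT K w' w → ∃ v ∈ M, WLT K w' v}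

/-- The convention for the weak supremum of the empty set. -/
theorem wsup_empty [AddCommGroup V] [TopologicalSpace V] (K : Set V) :
    wsup K (∅ : Set (ExtSpace V)) = {bot} := by
  ext w
  constructor
  · rintro ⟨-, h⟩
    cases w with
    | bot => rfl
    | fin v => obtain ⟨_, h', _⟩ := h bot trivial; exact h'.elim
    | top => obtain ⟨_, h', _⟩ := h bot trivial; exact h'.elim
  · rintro rfl
    refine ⟨fun v hv => hv.elim, fun w' hw' => ?_⟩
    cases w' <;> exact (hw' : False).elim

end

end ExtSpace

/-! ### Extended vector-valued mappings -/

section Mappings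

variable {X : Type uX} {V : Type uV}

/-- The effective domain of `F : X → V ∪ {-∞, +∞}`. -/
def effDom (F : X → ExtSpace V) : Set X := {x | F x ≠ ExtSpace.top}

/-- `F` is proper: its domain is nonempty and it does not take the value `-∞`. -/
def IsProper (F : X → ExtSpace V) : Prop := (effDom F).Nonempty ∧ ∀ x, F x ≠ ExtSpace.bot

/-- The `K`-epigraph `{(x, y) : y ∈ F(x) + K}` of `F`. -/
def epi [Add V] (K : Set V) (F : X → ExtSpace V) : Set (X × V) :=
  {p | ∃ v, F p.1 = ExtSpace.fin v ∧ ∃ k ∈ K, p.2 = v + k}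

open Classical in
/-- The indMap mapping of `D`. -/
noncomputable def indMap [Zero V] (D : Set X) : X → ExtSpace V :=
  fun x => if x ∈ D then ExtSpace.fin 0 else ExtSpace.top

/-- The composition `z* ∘ g` of a functional with an extended value, with
`z*(+∞) = +∞` (also for `z* = 0`). -/
noncomputable def dualComp [AddCommGroup V] [Module ℝ V] [TopologicalSpace V]
    (f : WeakDual ℝ V) : ExtSpace V → EReal
  | ExtSpace.bot => ⊥
  | ExtSpace.fin v => ((f v : ℝ) : EReal)
  | ExtSpace.top => ⊤

/-- The dual cone `K⁺`, a subset of the dual space (with its weak* topology). -/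
def dualCone [AddCommGroup V] [Module ℝ V] [TopologicalSpace V] (K : Set V) :
    Set (WeakDual ℝ V) :=
  {f | ∀ v ∈ K, 0 ≤ f v}

/-- `F` is `K`-convex: its `K`-epigraph is convex. -/
def IsKConvex [AddCommGroup X] [Module ℝ X] [AddCommGroup V] [Module ℝ V]
    (K : Set V) (F : X → ExtSpace V) : Prop :=
  Convex ℝ (epi K F)

/-- `F` is `K`-epi closed: its `K`-epigraph is closed. -/
def IsKEpiClosed [TopologicalSpace X] [AddCommGroup V] [TopologicalSpace V]
    (K : Set V) (F : X → ExtSpace V) : Prop :=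
  IsClosed (epi K F)

/-- `F` is positively `K`-lsc: `y* ∘ F` is lower semicontinuous for all nonzero `y* ∈ K⁺`. -/
def IsPositivelyLSC [TopologicalSpace X] [AddCommGroup V] [Module ℝ V] [TopologicalSpace V]
    (K : Set V) (F : X → ExtSpace V) : Prop :=
  ∀ f ∈ dualCone K, f ≠ 0 → LowerSemicontinuous (fun x => dualComp f (F x))

end Mappings

/-! ### Uniform `S⁺`-concavity and `S⁺`-uniform upper semicontinuity -/

section Uniform

variable {Z : Type uZ} {U : Type uU} {ι : Type uι}
  [AddCommGroup Z] [Module ℝ Z] [TopologicalSpace Z]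

/-- The family `(𝒢 ν)` of mappings `U → Z ∪ {+∞}` is uniformly `S⁺`-concave. -/
def UniformlyConcave (S : Set Z) (𝒢 : ι → U → ExtSpace Z) : Prop :=
  ∀ z₁ ∈ dualCone S, ∀ z₂ ∈ dualCone S, ∀ u₁ u₂ : U, ∃ z ∈ dualCone S, ∃ u : U,
    ∀ ν, dualComp z₁ (𝒢 ν u₁) + dualComp z₂ (𝒢 ν u₂) ≤ dualComp z (𝒢 ν u)

/-- The mapping `𝒢 : U → Z ∪ {+∞}` is `S⁺`-uniformly usc; nets are indexed by directed sets `D`,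
and convergence in the dual space is weak* convergence. -/
def UniformlyUSC [TopologicalSpace U] (S : Set Z) (𝒢 : U → ExtSpace Z) : Prop :=
  ∀ (D : Type (max uZ uU)) [Preorder D] [IsDirectedOrder D] [Nonempty D]
    (ζ : D → WeakDual ℝ Z) (υ : D → U) (ρ : D → ℝ) (z : WeakDual ℝ Z) (u : U) (r : ℝ),
    (∀ α, ζ α ∈ dualCone S) → z ∈ dualCone S →
    (∀ α, (ρ α : EReal) ≤ dualComp (ζ α) (𝒢 (υ α))) →
    Tendsto ζ atTop (𝓝 z) → Tendsto υ atTop (𝓝 u) → Tendsto ρ atTop (𝓝 r) →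
    (r : EReal) ≤ dualComp z (𝒢 u)

theorem isClosed_dualCone (S : Set Z) : IsClosed (dualCone S) := by
  have : dualCone S = ⋂ v ∈ S, {f : WeakDual ℝ Z | 0 ≤ f v} := by
    ext f; simp [dualCone]
  rw [this]
  exact isClosed_biInter fun v _ => isClosed_le continuous_const (WeakDual.eval_continuous v)

/-- The definition through nets says that a certain set is closed. -/
theorem uniformlyUSC_iff_isClosed [TopologicalSpace U] (S : Set Z) (𝒢 : U → ExtSpace Z) :
    UniformlyUSC S 𝒢 ↔ IsClosed {p : WeakDual ℝ Z × U × ℝ |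
      p.1 ∈ dualCone S ∧ (p.2.2 : EReal) ≤ dualComp p.1 (𝒢 p.2.1)} := by
  set A := {p : WeakDual ℝ Z × U × ℝ |
      p.1 ∈ dualCone S ∧ (p.2.2 : EReal) ≤ dualComp p.1 (𝒢 p.2.1)} with hA
  constructor
  · intro h
    refine isClosed_of_closure_subset fun p hp => ?_
    have hz : p.1 ∈ dualCone S := by
      have := (isClosed_dualCone S).preimage
        (continuous_fst : Continuous (Prod.fst : WeakDual ℝ Z × U × ℝ → WeakDual ℝ Z))
      exact closure_minimal (fun q hq => hq.1) this hp
    refine ⟨hz, ?_⟩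
    let D := {s : Set (WeakDual ℝ Z × U × ℝ) // s ∈ 𝓝 p}ᵒᵈ
    have hdir : IsDirectedOrder D := by
      refine ⟨fun s t => ⟨OrderDual.toDual ⟨s.1 ∩ t.1, inter_mem s.2 t.2⟩, ?_, ?_⟩⟩
      · exact (inter_subset_left : s.1 ∩ t.1 ⊆ s.1)
      · exact (inter_subset_right : s.1 ∩ t.1 ⊆ t.1)
    have hne : Nonempty D := ⟨OrderDual.toDual ⟨univ, univ_mem⟩⟩
    have hex : ∀ s : D, ∃ q, q ∈ s.1 ∩ A := fun s => mem_closure_iff_nhds.1 hp s.1 s.2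
    choose φ hφ using hex
    have hlim : Tendsto φ atTop (𝓝 p) := by
      intro s hs
      exact mem_map.2 (mem_of_superset (mem_atTop (OrderDual.toDual ⟨s, hs⟩ : D)) fun t ht => ht (hφ t).1)
    exact h D (fun s => (φ s).1) (fun s => (φ s).2.1) (fun s => (φ s).2.2) p.1 p.2.1 p.2.2
      (fun s => (hφ s).2.1) hz (fun s => (hφ s).2.2)
      ((continuous_fst.tendsto p).comp hlim)
      (((continuous_fst.comp continuous_snd).tendsto p).comp hlim)
      (((continuous_snd.comp continuous_snd).tendsto p).comp hlim)
  · intro h D _ _ _ ζ υ ρ z u r hζ _ hle hz hu hr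
    have := h.mem_of_tendsto (hz.prodMk_nhds (hu.prodMk_nhds hr))
      (Eventually.of_forall fun α => (⟨hζ α, hle α⟩ : (ζ α, υ α, ρ α) ∈ A))
    exact this.2

end Uniform

/-! ### Sectional convexity -/

/-- `N` is `E₀`-sectionally convex: `N ∩ (E₀ + v)` is convex for every `v`. -/
def SectionallyConvex {E : Type uV} [AddCommGroup E] [Module ℝ E] (E₀ : Submodule ℝ E)
    (N : Set E) : Prop :=
  ∀ v : E, Convex ℝ (N ∩ (fun e => e + v) '' (E₀ : Set E))

/-! ### Conjugate mappings and qualifying sets -/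

section Conjugate

variable {X : Type uX} {Y : Type uY} {Z : Type uZ} {U : Type uU}
  [AddCommGroup X] [Module ℝ X] [TopologicalSpace X]
  [AddCommGroup Y] [Module ℝ Y] [TopologicalSpace Y] [IsTopologicalAddGroup Y]
  [ContinuousSMul ℝ Y]
  [AddCommGroup Z] [Module ℝ Z] [TopologicalSpace Z]

/-- The conjugate mapping `F*(L) = WSup {L(x) - F(x) : x ∈ X}`. Here `X →Lₚₜ[ℝ] Y` is the space of
continuous linear maps with the topology of pointwise convergence. -/
def conjMap (K : Set Y) (F : X → ExtSpace Y) (L : X →Lₚₜ[ℝ] Y) : Set (ExtSpace Y) :=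
  ExtSpace.wsup K (range fun x => ExtSpace.fin (L x) + -F x)

/-- The `K`-epigraph `{(L, y) : y ∈ F*(L) + K}` of the conjugate mapping. -/
def epiConj (K : Set Y) (F : X → ExtSpace Y) : Set ((X →Lₚₜ[ℝ] Y) × Y) :=
  {p | ∃ v, ExtSpace.fin v ∈ conjMap K F p.1 ∧ ∃ k ∈ K, p.2 = v + k}

/-- The rank-one operator `k · x* : x ↦ ⟨x*, x⟩ k`. -/
noncomputable def rankOne (k : Y) (f : WeakDual ℝ X) : X →Lₚₜ[ℝ] Y :=
  UniformConvergenceCLM.ofFun _ _ _ ((WeakDual.toStrongDual f).smulRight k)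

/-- The subspace `E_k = k · (X* × ℝ)` of `𝓛(X, Y) × Y`. -/
def sectionSpace (X : Type uX) [AddCommGroup X] [Module ℝ X] [TopologicalSpace X] (k : Y) :
    Submodule ℝ ((X →Lₚₜ[ℝ] Y) × Y) where
  carrier := {p | ∃ (f : WeakDual ℝ X) (r : ℝ), p = (rankOne k f, r • k)}
  add_mem' := by
    rintro _ _ ⟨f, r, rfl⟩ ⟨g, s, rfl⟩
    refine ⟨f + g, r + s, Prod.ext ?_ (add_smul r s k).symm⟩
    exact DFunLike.ext _ _ fun x => (add_smul (f x) (g x) k).symm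
  zero_mem' := by
    refine ⟨0, 0, Prod.ext ?_ (zero_smul ℝ k).symm⟩
    exact DFunLike.ext _ _ fun x => (zero_smul ℝ k).symm
  smul_mem' := by
    rintro c _ ⟨f, r, rfl⟩
    refine ⟨c • f, c * r, Prod.ext ?_ (mul_smul c r k).symm⟩
    exact DFunLike.ext _ _ fun x => (mul_smul c (f x) k).symm

/-- `k`-sectional convexity of a subset of `𝓛(X, Y) × Y`. -/
def KSectionallyConvex (k : Y) (N : Set ((X →Lₚₜ[ℝ] Y) × Y)) : Prop :=
  SectionallyConvex (sectionSpace X k) N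

/-- The composition `T ∘ G`, equal to `+∞` where `G` is. -/
noncomputable def opComp (T : Z →Lₚₜ[ℝ] Y) (G : X → ExtSpace Z) : X → ExtSpace Y := fun x => (G x).map T

/-- The cone of positive operators `𝓛₊(S, K)`. -/
def posOps (S : Set Z) (K : Set Y) : Set (Z →Lₚₜ[ℝ] Y) := {T | T '' S ⊆ K}

/-- The cone of weakly positive operators `𝓛₊ʷ(S, K)`. -/
def weakPosOps (S : Set Z) (K : Set Y) : Set (Z →Lₚₜ[ℝ] Y) :=
  {T | T '' S ∩ -interior K = ∅}

/-- The feasible set `A = C ∩ ⋂ᵤ Gᵤ⁻¹(-S)`. -/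
def feasible (S : Set Z) (C : Set X) (G : U → X → ExtSpace Z) : Set X :=
  C ∩ ⋂ u, {x | ∃ z ∈ -S, G u x = ExtSpace.fin z}

/-- The qualifying set `𝒜`. -/
def setA (K : Set Y) (S : Set Z) (C : Set X) (F : X → ExtSpace Y) (G : U → X → ExtSpace Z) :
    Set ((X →Lₚₜ[ℝ] Y) × Y) :=
  ⋃ T ∈ posOps S K, ⋃ u : U, epiConj K (fun x => F x + indMap C x + opComp T (G u) x)

/-- The weak qualifying set `ℬ`: the set `epi(…)* + (0, v)` is the image of `epi(…)*` under the
translation by `(0, v)`, and `v` runs through `I*_{-S}(T)`. -/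
def setB (K : Set Y) (S : Set Z) (C : Set X) (F : X → ExtSpace Y) (G : U → X → ExtSpace Z) :
    Set ((X →Lₚₜ[ℝ] Y) × Y) :=
  ⋃ T ∈ weakPosOps S K, ⋃ u : U,
    ⋂ (v : Y) (_ : ExtSpace.fin v ∈ conjMap K (indMap (-S)) T),
      (fun p => p + (0, v)) ''
        epiConj K (fun x => F x + indMap C x + opComp T (G u) x)

/-- The qualifying set `𝒜ₖ`. -/
def setAk (K : Set Y) (S : Set Z) (C : Set X) (F : X → ExtSpace Y) (G : U → X → ExtSpace Z) (k : Y) :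
    Set ((X →Lₚₜ[ℝ] Y) × Y) :=
  ⋃ f ∈ dualCone S, ⋃ u : U,
    epiConj K (fun x => F x + indMap C x + opComp (rankOne k f) (G u) x)

end Conjugate

end RobustVO

open RobustVO

namespace RobustVO

/-! ### Interiors of convex cones -/

section Cone

open scoped Pointwise

variable {Y : Type*} [AddCommGroup Y] [Module ℝ Y] [TopologicalSpace Y] {K : ConvexCone ℝ Y}

/-! The four sets coincide because they form a cycle of inclusions: epi(F+I_A)* ⊆ 𝒜ₖ ⊆ 𝒜 ⊆ ℬ ⊆
epi(F+I_A)*. Closedness and sectional convexity then need checking only for the epigraph of a single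
conjugate. There (L, y) ∈ epi H* means L(x) - H(x) - y ∉ int K for every x in the domain
(`mem_epiConj_iff`), an intersection of closed conditions. Along E_k each of them reads c + s•k ∉
int K with s affine, hence bounds s from above.

The substantial inclusion is the first one. Given (L, y) ∈ epi(F+I_A)*, a functional f ∈ K⁺ with
f(k) = 1 separates int K from the values L(x) - F(x) - y on A, so the convex function φ = f(F - L +
y) is nonnegative on A. Scalar robust duality (`exists_robust_multiplier`) gives z*, u with φ +
z*∘G_u ≥ 0 on C ∩ dom F, and f(k) = 1 turns this into membership for the operator k·z*.

The scalar duality has two steps. For finitely many points, (H1) makes the attainable lower bounds a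
convex cone in a finite-dimensional space, and a separating hyperplane would produce a convex
combination of the points that is feasible with φ < 0. The passage to all points is a finite
intersection argument: the Slater condition, (H2) and compactness of 𝒰 confine the multipliers to a
weak* compact slice of S⁺. -/

theorem zero_mem_of_isClosed_cone [ContinuousSMul ℝ Y] (hK : IsClosed (K : Set Y))
    (hne : (K : Set Y).Nonempty) : (0 : Y) ∈ K := by
  obtain ⟨k, hk⟩ := hne
  have hlim : Tendsto (fun t : ℝ => t • k) (𝓝[>] 0) (𝓝 0) := by
    have : Continuous fun t : ℝ => t • k := by fun_prop
    simpa using (this.tendsto 0).mono_left nhdsWithin_le_nhds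
  exact hK.mem_of_tendsto hlim
    (eventually_nhdsWithin_of_forall fun t ht => K.smul_mem ht hk)

theorem zero_notMem_interior_cone [ContinuousSMul ℝ Y] (hK : (K : Set Y) ≠ univ) : (0 : Y) ∉ interior (K : Set Y) := by
  intro h0
  refine hK (eq_univ_of_forall fun y => ?_)
  have hlim : Tendsto (fun t : ℝ => t • y) (𝓝[>] 0) (𝓝 0) := by
    have : Continuous fun t : ℝ => t • y := by fun_prop
    simpa using (this.tendsto 0).mono_left nhdsWithin_le_nhds
  obtain ⟨t, ht, ht0⟩ :=
    ((hlim.eventually (mem_interior_iff_mem_nhds.1 h0)).and self_mem_nhdsWithin).exists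
  have h := K.smul_mem (inv_pos.2 ht0) ht
  rwa [inv_smul_smul₀ (ne_of_gt ht0)] at h

theorem smul_mem_interior_cone [ContinuousSMul ℝ Y] {k : Y} {t : ℝ} (ht : 0 < t) (hk : k ∈ interior (K : Set Y)) :
    t • k ∈ interior (K : Set Y) := by
  have h : t • interior (K : Set Y) ⊆ interior (K : Set Y) := by
    rw [← interior_smul₀ ht.ne']
    refine interior_mono ?_
    rintro _ ⟨a, ha, rfl⟩
    exact K.smul_mem ht ha
  exact h ⟨k, hk, rfl⟩

variable [IsTopologicalAddGroup Y]

theorem add_mem_interior_cone {k κ : Y} (hk : k ∈ interior (K : Set Y)) (hκ : κ ∈ K) :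
    k + κ ∈ interior (K : Set Y) := by
  have h : interior (K : Set Y) + (K : Set Y) ⊆ interior (K : Set Y) := by
    refine subset_interior_add_left.trans (interior_mono ?_)
    rintro _ ⟨a, ha, b, hb, rfl⟩
    exact K.add_mem ha hb
  exact h ⟨k, hk, κ, hκ, rfl⟩

variable [ContinuousSMul ℝ Y]

theorem exists_add_smul_mem_interior_cone {k : Y} (hk : k ∈ interior (K : Set Y)) (h : Y) :
    ∃ ε : ℝ, 0 < ε ∧ k + ε • h ∈ interior (K : Set Y) := by
  have hlim : Tendsto (fun t : ℝ => k + t • h) (𝓝[>] 0) (𝓝 k) := by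
    have : Continuous fun t : ℝ => k + t • h := by fun_prop
    simpa using (this.tendsto 0).mono_left nhdsWithin_le_nhds
  obtain ⟨t, ht, ht0⟩ :=
    ((hlim.eventually (isOpen_interior.mem_nhds hk)).and self_mem_nhdsWithin).exists
  exact ⟨t, ht0, ht⟩

theorem smul_add_mem_interior_cone_of_le {k c : Y} {s t : ℝ} (hk : k ∈ interior (K : Set Y))
    (hst : s ≤ t) (h : c + s • k ∈ interior (K : Set Y)) : c + t • k ∈ interior (K : Set Y) := by
  rcases hst.eq_or_lt with rfl | hlt
  · exact h
  · have := add_mem_interior_cone h (interior_subset (smul_mem_interior_cone (sub_pos.2 hlt) hk))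
    rwa [add_assoc, ← add_smul, add_sub_cancel] at this

/-- A nontrivial ray in an interior direction meets the weak supremum of a set that is bounded
above along the ray. -/
theorem exists_fin_mem_wsup {M : Set (ExtSpace Y)} {k y₀ m₀ : Y} (hk : k ∈ interior (K : Set Y))
    (htop : ExtSpace.top ∉ M) (hm₀ : ExtSpace.fin m₀ ∈ M)
    (hbdd : ∃ t : ℝ, ∀ v, ExtSpace.fin v ∈ M → v - (y₀ + t • k) ∉ interior (K : Set Y)) :
    ∃ t : ℝ, ExtSpace.fin (y₀ + t • k) ∈ ExtSpace.wsup (K : Set Y) M ∧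
      ∀ t' : ℝ, (∀ v, ExtSpace.fin v ∈ M → v - (y₀ + t' • k) ∉ interior (K : Set Y)) →
        t ≤ t' := by
  -- Parameters whose point on the ray lies weakly below no finite value of M. This set is closed
  -- and bounded below, and its least element gives the required point.
  set B : Set ℝ :=
    {t | ∀ v, ExtSpace.fin v ∈ M → v - (y₀ + t • k) ∉ interior (K : Set Y)} with hB
  have hclosed : IsClosed B := by
    have : B = ⋂ (v : Y) (_ : ExtSpace.fin v ∈ M),
        {t : ℝ | v - (y₀ + t • k) ∈ (interior (K : Set Y))ᶜ} := by
      ext t; simp [hB]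
    rw [this]
    exact isClosed_iInter fun v => isClosed_iInter fun _ =>
      isOpen_interior.isClosed_compl.preimage (by fun_prop)
  have hbelow : BddBelow B := by
    obtain ⟨ε, hε, hmem⟩ := exists_add_smul_mem_interior_cone hk (m₀ - y₀)
    refine ⟨-ε⁻¹, fun t ht => le_of_not_gt fun hlt => ht m₀ hm₀ ?_⟩
    have h1 := smul_mem_interior_cone (inv_pos.2 hε) hmem
    rw [smul_add, inv_smul_smul₀ hε.ne', add_comm] at h1
    have h2 := smul_add_mem_interior_cone_of_le hk (t := -t) (by linarith) h1
    convert h2 using 1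
    rw [neg_smul]; abel
  have hmin : sInf B ∈ B := hclosed.csInf_mem hbdd hbelow
  refine ⟨sInf B, ⟨fun v hv hlt => ?_, fun w' hw' => ?_⟩, fun t' ht' => csInf_le hbelow ht'⟩
  · cases v with
    | bot => exact hlt
    | top => exact htop hv
    | fin v =>
      refine hmin v hv ?_
      have h : -(y₀ + sInf B • k - v) ∈ interior (K : Set Y) := hlt
      rwa [neg_sub] at h
  · cases w' with
    | bot => exact ⟨_, hm₀, trivial⟩
    | top => exact (hw' : False).elim
    | fin w =>
      have h : -(w - (y₀ + sInf B • k)) ∈ interior (K : Set Y) := hw'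
      -- Openness leaves room for a margin ε•k below the candidate. Since `sInf B - ε` is not in
      -- `B`, some value of M lies strictly above the lowered point, hence above w.
      obtain ⟨ε, hε, hmem⟩ := exists_add_smul_mem_interior_cone h (-k)
      have hnot : sInf B - ε ∉ B := notMem_of_lt_csInf (by linarith) hbelow
      simp only [hB, mem_ofPred_eq, not_forall, not_not] at hnot
      obtain ⟨v, hv, hvk⟩ := hnot
      refine ⟨_, hv, ?_⟩
      change -(w - v) ∈ interior (K : Set Y)
      have h2 := add_mem_interior_cone hmem (interior_subset hvk)
      convert h2 using 1
      rw [sub_smul, smul_neg]; abel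

end Cone

/-! ### Arithmetic of extended values -/

section Ext

variable {V : Type*} {W : Type*}

theorem ExtSpace.add_eq_fin_iff [Add V] {a b : ExtSpace V} {v : V} :
    a + b = ExtSpace.fin v ↔
      ∃ x y, a = ExtSpace.fin x ∧ b = ExtSpace.fin y ∧ v = x + y := by
  change ExtSpace.add a b = _ ↔ _
  cases a <;> cases b <;> simp [ExtSpace.add, eq_comm]

theorem ExtSpace.add_ne_bot [Add V] {a b : ExtSpace V} (ha : a ≠ ExtSpace.bot)
    (hb : b ≠ ExtSpace.bot) : a + b ≠ ExtSpace.bot := by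
  change ExtSpace.add a b ≠ _
  cases a <;> cases b <;> simp_all [ExtSpace.add]

theorem ExtSpace.fin_add_neg_eq_fin_iff [AddGroup V] {a v : V} {b : ExtSpace V} :
    ExtSpace.fin a + -b = ExtSpace.fin v ↔ ∃ w, b = ExtSpace.fin w ∧ v = a - w := by
  change ExtSpace.add _ (ExtSpace.neg b) = _ ↔ _
  cases b <;> simp [ExtSpace.add, ExtSpace.neg, eq_comm, sub_eq_add_neg]

theorem ExtSpace.fin_add_neg_eq_top_iff [AddGroup V] {a : V} {b : ExtSpace V} :
    ExtSpace.fin a + -b = ExtSpace.top ↔ b = ExtSpace.bot := by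
  change ExtSpace.add _ (ExtSpace.neg b) = _ ↔ _
  cases b <;> simp [ExtSpace.add, ExtSpace.neg]

theorem ExtSpace.map_eq_fin_iff {f : V → W} {a : ExtSpace V} {w : W} :
    a.map f = ExtSpace.fin w ↔ ∃ v, a = ExtSpace.fin v ∧ w = f v := by
  cases a <;> simp [ExtSpace.map, eq_comm]

theorem ExtSpace.map_ne_bot {f : V → W} {a : ExtSpace V} (ha : a ≠ ExtSpace.bot) :
    a.map f ≠ ExtSpace.bot := by
  cases a <;> simp_all [ExtSpace.map]

theorem indMap_eq_fin_iff {X : Type*} [Zero V] {D : Set X} {x : X} {v : V} :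
    indMap D x = ExtSpace.fin v ↔ x ∈ D ∧ v = 0 := by
  by_cases h : x ∈ D <;> simp [indMap, h, eq_comm]

theorem indMap_ne_bot {X : Type*} [Zero V] {D : Set X} {x : X} :
    indMap (V := V) D x ≠ ExtSpace.bot := by
  by_cases h : x ∈ D <;> simp [indMap, h]

theorem add_indMap_eq_fin_iff {X : Type*} [AddMonoid V] {F : X → ExtSpace V} {D : Set X} {x : X}
    {v : V} : F x + indMap D x = ExtSpace.fin v ↔ F x = ExtSpace.fin v ∧ x ∈ D := by
  rw [ExtSpace.add_eq_fin_iff]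
  constructor
  · rintro ⟨a, b, ha, hb, rfl⟩
    obtain ⟨hD, rfl⟩ := indMap_eq_fin_iff.1 hb
    exact ⟨by rw [ha, add_zero], hD⟩
  · rintro ⟨ha, hD⟩
    exact ⟨v, 0, ha, indMap_eq_fin_iff.2 ⟨hD, rfl⟩, (add_zero v).symm⟩

theorem IsProper.exists_eq_fin {X : Type*} {F : X → ExtSpace V} (hF : IsProper F) {x : X}
    (hx : x ∈ effDom F) : ∃ v, F x = ExtSpace.fin v := by
  have h1 := hF.2 x
  have h2 : F x ≠ ExtSpace.top := hx
  cases h : F x with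
  | bot => exact (h1 h).elim
  | top => exact (h2 h).elim
  | fin v => exact ⟨v, rfl⟩

theorem mem_effDom_of_eq_fin {X : Type*} {F : X → ExtSpace V} {x : X} {v : V}
    (h : F x = ExtSpace.fin v) : x ∈ effDom F := by
  change F x ≠ _
  rw [h]
  exact fun h => by cases h

theorem add_indMap_add_opComp_eq_fin_iff {X Y Z : Type*}
    [AddCommGroup Y] [Module ℝ Y] [TopologicalSpace Y]
    [AddCommGroup Z] [Module ℝ Z] [TopologicalSpace Z]
    {F : X → ExtSpace Y} {C : Set X} {T : Z →Lₚₜ[ℝ] Y} {g : X → ExtSpace Z}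
    {x : X} {v : Y} :
    F x + indMap C x + opComp T g x = ExtSpace.fin v ↔
      ∃ a z, F x = ExtSpace.fin a ∧ x ∈ C ∧ g x = ExtSpace.fin z ∧ v = a + T z := by
  rw [ExtSpace.add_eq_fin_iff]
  constructor
  · rintro ⟨a, b, ha, hb, rfl⟩
    obtain ⟨hFa, hC⟩ := add_indMap_eq_fin_iff.1 ha
    obtain ⟨z, hz, rfl⟩ := ExtSpace.map_eq_fin_iff.1 hb
    exact ⟨a, z, hFa, hC, hz, rfl⟩
  · rintro ⟨a, z, ha, hC, hz, rfl⟩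
    exact ⟨a, T z, add_indMap_eq_fin_iff.2 ⟨ha, hC⟩, ExtSpace.map_eq_fin_iff.2 ⟨z, hz, rfl⟩, rfl⟩

theorem mem_feasible_iff {X Z U : Type*} [AddCommGroup Z] [Module ℝ Z] {S : ConvexCone ℝ Z}
    {C : Set X} {G : U → X → ExtSpace Z} {x : X} : x ∈ feasible (S : Set Z) C G ↔
    x ∈ C ∧ ∀ u, ∃ z, -z ∈ S ∧ G u x = ExtSpace.fin z := by
  simp [feasible]

/-- G_u(x) ∈ -S says exactly that (x, 0) is in the S-epigraph of G_u, so each constraint set is a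
slice of a convex set. -/
theorem convex_feasible {X Z U : Type*} [AddCommGroup X] [Module ℝ X] [AddCommGroup Z] [Module ℝ Z]
    {S : ConvexCone ℝ Z} {C : Set X} {G : U → X → ExtSpace Z} (hC : Convex ℝ C) (hG : ∀ u, IsKConvex (S : Set Z) (G u)) : Convex ℝ (feasible (S : Set Z) C G) := by
  have h : ∀ u x, x ∈ {x | ∃ z ∈ -(S : Set Z), G u x = ExtSpace.fin z} ↔
      (x, (0 : Z)) ∈ epi (S : Set Z) (G u) := by
    intro u x
    constructor
    · rintro ⟨z, hz, hzx⟩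
      exact ⟨z, hzx, -z, hz, (add_neg_cancel z).symm⟩
    · rintro ⟨z, hzx, s, hs, hzs⟩
      refine ⟨z, ?_, hzx⟩
      rw [eq_neg_of_add_eq_zero_left (show z + s = 0 from hzs.symm)]
      simpa using hs
  refine hC.inter (convex_iInter fun u x hx y hy a b ha hb hab => (h u _).2 ?_)
  have := hG u ((h u x).1 hx) ((h u y).1 hy) ha hb hab
  simpa using this

@[simp] theorem rankOne_apply {X Y : Type*} [AddCommGroup X] [Module ℝ X]
    [TopologicalSpace X] [AddCommGroup Y] [Module ℝ Y] [TopologicalSpace Y] [ContinuousSMul ℝ Y]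
    (k : Y) (f : WeakDual ℝ X) (x : X) :
    rankOne k f x = f x • k := rfl

end Ext

/-! ### Epigraphs of conjugates -/

section Conjugate

variable {X Y Z U : Type*}
  [AddCommGroup X] [Module ℝ X] [TopologicalSpace X]
  [AddCommGroup Y] [Module ℝ Y] [TopologicalSpace Y] [IsTopologicalAddGroup Y]
  [ContinuousSMul ℝ Y]
  [AddCommGroup Z] [Module ℝ Z] [TopologicalSpace Z]
  {K : ConvexCone ℝ Y} {S : ConvexCone ℝ Z}
  {C : Set X} {F : X → ExtSpace Y} {G : U → X → ExtSpace Z}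

/-- For a proper mapping `H`, membership in `epi H*` amounts to a system of non-inclusions. -/
theorem mem_epiConj_iff (hK_closed : IsClosed (K : Set Y))
    (hK_int : (interior (K : Set Y)).Nonempty) {H : X → ExtSpace Y}
    (hbot : ∀ x, H x ≠ ExtSpace.bot) (hdom : ∃ x v, H x = ExtSpace.fin v)
    {p : (X →Lₚₜ[ℝ] Y) × Y} :
    p ∈ epiConj (K : Set Y) H ↔
      ∀ x v, H x = ExtSpace.fin v → p.1 x - v - p.2 ∉ interior (K : Set Y) := by
  obtain ⟨k, hk⟩ := hK_int
  constructor
  · rintro ⟨v, hv, κ, hκ, hp⟩ x w hw hmem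
    refine hv.1 _ ⟨x, ExtSpace.fin_add_neg_eq_fin_iff.2 ⟨w, hw, rfl⟩⟩ ?_
    change -(v - (p.1 x - w)) ∈ interior (K : Set Y)
    have h := add_mem_interior_cone hmem hκ
    rw [hp] at h
    convert h using 1
    abel
  · intro h
    obtain ⟨x₀, v₀, hx₀⟩ := hdom
    have hfin : ∀ v, ExtSpace.fin v ∈ range (fun x => ExtSpace.fin (p.1 x) + -H x) →
        v - (p.2 + (0 : ℝ) • k) ∉ interior (K : Set Y) := by
      rintro v ⟨x, hx⟩
      obtain ⟨w, hw, rfl⟩ := ExtSpace.fin_add_neg_eq_fin_iff.1 hx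
      rw [zero_smul, add_zero]
      exact h x w hw
    -- On the line through `p.2` in direction k, parameter 0 is already an upper bound in the weak
    -- sense. So the line meets H*(L) at some t ≤ 0, and (-t)•k ∈ K is the required remainder.
    obtain ⟨t, ht, hle⟩ := exists_fin_mem_wsup hk
      (M := range (fun x => ExtSpace.fin (p.1 x) + -H x)) (y₀ := p.2)
      (by rintro ⟨x, hx⟩; exact hbot x (ExtSpace.fin_add_neg_eq_top_iff.1 hx))
      ⟨x₀, ExtSpace.fin_add_neg_eq_fin_iff.2 ⟨v₀, hx₀, rfl⟩⟩ ⟨0, hfin⟩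
    have ht0 : t ≤ 0 := hle 0 hfin
    refine ⟨_, ht, (-t) • k, ?_, by rw [neg_smul]; abel⟩
    rcases ht0.eq_or_lt with rfl | hlt
    · simpa using zero_mem_of_isClosed_cone hK_closed ⟨k, interior_subset hk⟩
    · exact K.smul_mem (neg_pos.2 hlt) (interior_subset hk)

theorem continuous_pointwise_eval (x : X) : Continuous fun L : X →Lₚₜ[ℝ] Y => L x :=
  (PointwiseConvergenceCLM.evalCLM (RingHom.id ℝ) Y x).continuous

theorem isClosed_epiConj (hK_closed : IsClosed (K : Set Y))
    (hK_int : (interior (K : Set Y)).Nonempty) {H : X → ExtSpace Y}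
    (hbot : ∀ x, H x ≠ ExtSpace.bot) (hdom : ∃ x v, H x = ExtSpace.fin v) :
    IsClosed (epiConj (K : Set Y) H) := by
  have : epiConj (K : Set Y) H = ⋂ (x : X) (v : Y) (_ : H x = ExtSpace.fin v),
      {p : (X →Lₚₜ[ℝ] Y) × Y | p.1 x - v - p.2 ∈ (interior (K : Set Y))ᶜ} := by
    ext p
    simp [mem_epiConj_iff hK_closed hK_int hbot hdom]
  rw [this]
  refine isClosed_iInter fun x => isClosed_iInter fun v => isClosed_iInter fun _ =>
    isOpen_interior.isClosed_compl.preimage ?_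
  exact (((continuous_pointwise_eval x).comp continuous_fst).sub continuous_const).sub
    continuous_snd

theorem kSectionallyConvex_epiConj (hK_closed : IsClosed (K : Set Y)) {k : Y}
    (hk : k ∈ interior (K : Set Y)) {H : X → ExtSpace Y}
    (hbot : ∀ x, H x ≠ ExtSpace.bot) (hdom : ∃ x v, H x = ExtSpace.fin v) :
    KSectionallyConvex k (epiConj (K : Set Y) H) := by
  intro w
  have himg : Convex ℝ ((fun e => e + w) '' (sectionSpace X k : Set ((X →Lₚₜ[ℝ] Y) × Y))) := by
    have h := (sectionSpace (Y := Y) X k).convex.translate w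
    simpa [add_comm] using h
  rintro _ ⟨hp, ⟨_, ⟨f, r, rfl⟩, rfl⟩⟩ _ ⟨hq, ⟨_, ⟨g, s, rfl⟩, rfl⟩⟩ a b ha hb hab
  refine ⟨?_, himg ⟨_, ⟨f, r, rfl⟩, rfl⟩ ⟨_, ⟨g, s, rfl⟩, rfl⟩ ha hb hab⟩
  rw [mem_epiConj_iff hK_closed ⟨k, hk⟩ hbot hdom] at hp hq ⊢
  intro x v hv hmem
  have key : ∀ (f : WeakDual ℝ X) (r : ℝ),
      ((rankOne k f, r • k) + w : (X →Lₚₜ[ℝ] Y) × Y).1 x - v -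
        ((rankOne k f, r • k) + w : (X →Lₚₜ[ℝ] Y) × Y).2
      = (w.1 x - v - w.2) + (f x - r) • k := by
    intro f r
    change f x • k + w.1 x - v - (r • k + w.2) = _
    rw [sub_smul]; abel
  have hcomb : (a • ((rankOne k f, r • k) + w : (X →Lₚₜ[ℝ] Y) × Y) +
        b • ((rankOne k g, s • k) + w)).1 x - v -
      (a • ((rankOne k f, r • k) + w : (X →Lₚₜ[ℝ] Y) × Y) +
        b • ((rankOne k g, s • k) + w)).2
      = (w.1 x - v - w.2) + (a * (f x - r) + b * (g x - s)) • k := by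
    change a • (f x • k + w.1 x) + b • (g x • k + w.1 x) - v -
      (a • (r • k + w.2) + b • (s • k + w.2)) = _
    have hb' : b = 1 - a := by linarith
    subst hb'
    module
  have h1 := hp x v hv
  have h2 := hq x v hv
  rw [key] at h1 h2
  rw [hcomb] at hmem
  -- A convex combination is at most the larger of the two coefficients, and enlarging the
  -- coefficient of k stays in int K, which contradicts the hypothesis for that endpoint.
  rcases le_total (f x - r) (g x - s) with hle | hle
  · refine h2 (smul_add_mem_interior_cone_of_le hk ?_ hmem)
    calc _ ≤ a * (g x - s) + b * (g x - s) := by gcongr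
      _ = _ := by rw [← add_mul, hab, one_mul]
  · refine h1 (smul_add_mem_interior_cone_of_le hk ?_ hmem)
    calc _ ≤ a * (f x - r) + b * (f x - r) := by gcongr
      _ = _ := by rw [← add_mul, hab, one_mul]

theorem mem_epiConj_add_indMap_feasible_iff [Nonempty U]
    (hK_closed : IsClosed (K : Set Y)) (hK_int : (interior (K : Set Y)).Nonempty)
    (hF_proper : IsProper F)
    (hfeas : (feasible (S : Set Z) C G ∩ effDom F).Nonempty)
    {p : (X →Lₚₜ[ℝ] Y) × Y} :
    p ∈ epiConj (K : Set Y) (fun x => F x + indMap (feasible (S : Set Z) C G) x) ↔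
      ∀ x ∈ feasible (S : Set Z) C G, ∀ a, F x = ExtSpace.fin a →
        p.1 x - a - p.2 ∉ interior (K : Set Y) := by
  rw [mem_epiConj_iff hK_closed hK_int
    (fun x => ExtSpace.add_ne_bot (hF_proper.2 x) indMap_ne_bot)]
  · simp only [add_indMap_eq_fin_iff]
    exact ⟨fun h x hx a ha => h x a ⟨ha, hx⟩, fun h x a ha => h x ha.2 a ha.1⟩
  · obtain ⟨x, hx, hxF⟩ := hfeas
    obtain ⟨a, ha⟩ := hF_proper.exists_eq_fin hxF
    exact ⟨x, a, add_indMap_eq_fin_iff.2 ⟨ha, hx⟩⟩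

theorem mem_epiConj_add_opComp_iff [Nonempty U]
    (hK_closed : IsClosed (K : Set Y)) (hK_int : (interior (K : Set Y)).Nonempty)
    (hF_proper : IsProper F) (hG_proper : ∀ u, IsProper (G u))
    (hfeas : (feasible (S : Set Z) C G ∩ effDom F).Nonempty)
    {T : Z →Lₚₜ[ℝ] Y} {u : U}
    {p : (X →Lₚₜ[ℝ] Y) × Y} :
    p ∈ epiConj (K : Set Y) (fun x => F x + indMap C x + opComp T (G u) x) ↔
      ∀ x ∈ C, ∀ a z, F x = ExtSpace.fin a → G u x = ExtSpace.fin z →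
        p.1 x - (a + T z) - p.2 ∉ interior (K : Set Y) := by
  rw [mem_epiConj_iff hK_closed hK_int (H := fun x => F x + indMap C x + opComp T (G u) x)
    (fun x => ExtSpace.add_ne_bot (ExtSpace.add_ne_bot (hF_proper.2 x) indMap_ne_bot)
      (ExtSpace.map_ne_bot ((hG_proper u).2 x)))]
  · simp only [add_indMap_add_opComp_eq_fin_iff]
    exact ⟨fun h x hx a z ha hz => h x _ ⟨a, z, ha, hx, hz, rfl⟩,
      fun h x v ⟨a, z, ha, hx, hz, hv⟩ => hv ▸ h x hx a z ha hz⟩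
  · obtain ⟨x, hx, hxF⟩ := hfeas
    obtain ⟨a, ha⟩ := hF_proper.exists_eq_fin hxF
    obtain ⟨hC, hG⟩ := mem_feasible_iff.1 hx
    obtain ⟨z, -, hz⟩ := hG u
    exact ⟨x, _, add_indMap_add_opComp_eq_fin_iff.2 ⟨a, z, ha, hC, hz, rfl⟩⟩

end Conjugate

/-! ### Lagrange multipliers for a scalar robust problem -/

section Multiplier

theorem le_dualComp_smul {V : Type*} [AddCommGroup V] [Module ℝ V] [TopologicalSpace V]
    {z : WeakDual ℝ V} {g : ExtSpace V} {a t : ℝ} (ht : 0 ≤ t)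
    (h : (a : EReal) ≤ dualComp z g) : ((t * a : ℝ) : EReal) ≤ dualComp (t • z) g := by
  cases g with
  | bot => exact absurd h (by simp [dualComp])
  | top => simp [dualComp]
  | fin v =>
    have h' : a ≤ z v := EReal.coe_le_coe_iff.1 h
    exact EReal.coe_le_coe_iff.2 (mul_le_mul_of_nonneg_left h' ht)

theorem zero_le_dualComp_zero {V : Type*} [AddCommGroup V] [Module ℝ V] [TopologicalSpace V]
    {g : ExtSpace V} (hg : g ≠ ExtSpace.bot) : (0 : EReal) ≤ dualComp (0 : WeakDual ℝ V) g := by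
  cases g with
  | bot => exact (hg rfl).elim
  | top => simp [dualComp]
  | fin v => exact EReal.coe_le_coe_iff.2 le_rfl

theorem smul_mem_dualCone {V : Type*} [AddCommGroup V] [Module ℝ V] [TopologicalSpace V]
    {S : Set V} {z : WeakDual ℝ V} {t : ℝ} (ht : 0 ≤ t) (hz : z ∈ dualCone S) :
    t • z ∈ dualCone S := fun v hv => mul_nonneg ht (hz v hv)

theorem zero_mem_dualCone {V : Type*} [AddCommGroup V] [Module ℝ V] [TopologicalSpace V]
    {S : Set V} : (0 : WeakDual ℝ V) ∈ dualCone S := fun _ _ => le_rfl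

variable {Z : Type*} [NormedAddCommGroup Z] [NormedSpace ℝ Z] {S : ConvexCone ℝ Z}

theorem exists_mem_dualCone_pos (hS : IsClosed (S : Set Z)) (hne : (S : Set Z).Nonempty) {v : Z}
    (hv : -v ∉ S) : ∃ f ∈ dualCone (S : Set Z), 0 < f v := by
  obtain ⟨f, c, hfc, hcS⟩ := geometric_hahn_banach_point_closed S.convex hS hv
  have h0 : c < 0 := by simpa using hcS 0 (zero_mem_of_isClosed_cone hS hne)
  refine ⟨StrongDual.toWeakDual f, fun b hb => ?_, ?_⟩
  · change 0 ≤ f b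
    by_contra! hlt
    have h := hcS _ (S.smul_mem (div_pos_of_neg_of_neg h0 hlt) hb)
    rw [map_smul, smul_eq_mul, div_mul_cancel₀ _ hlt.ne] at h
    exact lt_irrefl _ h
  · change 0 < f v
    rw [map_neg] at hfc
    linarith

/-- A slice of the dual cone cut off by an interior point is weak* compact. -/
theorem isCompact_dualCone_le {s₀ : Z} (hs₀ : s₀ ∈ interior (S : Set Z)) (R : ℝ) :
    IsCompact {z : WeakDual ℝ Z | z ∈ dualCone (S : Set Z) ∧ z s₀ ≤ R} := by
  obtain ⟨r, hr, hball⟩ := Metric.mem_nhds_iff.1 (mem_interior_iff_mem_nhds.1 hs₀)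
  -- On the ball of radius r/(|R|+1) both s₀ ± (|R|+1)•h lie in S, whence |z h| ≤ R/(|R|+1) < 1. The
  -- slice is therefore a closed subset of the polar of a ball, and Banach–Alaoglu applies.
  have hR : 0 < |R| + 1 := by positivity
  refine (WeakDual.isCompact_polar ℝ (Metric.ball_mem_nhds (0 : Z) (div_pos hr hR))).of_isClosed_subset
    ((isClosed_dualCone _).inter (isClosed_le (WeakDual.eval_continuous s₀) continuous_const)) ?_
  rintro z ⟨hz, hzR⟩ h hh
  have hnorm : ‖(|R| + 1) • h‖ < r := by
    rw [norm_smul, Real.norm_of_nonneg hR.le, mul_comm]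
    exact (lt_div_iff₀ hR).1 (by simpa using hh)
  have h1 : 0 ≤ z (s₀ + (|R| + 1) • h) := hz _ (hball (by simpa using hnorm))
  have h2 : 0 ≤ z (s₀ - (|R| + 1) • h) := hz _ (hball (by
    rw [Metric.mem_ball, dist_eq_norm, sub_sub_cancel_left, norm_neg]; exact hnorm))
  rw [map_add, map_smul, smul_eq_mul] at h1
  rw [map_sub, map_smul, smul_eq_mul] at h2
  have hRR := le_abs_self R
  change ‖z h‖ ≤ 1
  rw [Real.norm_eq_abs, abs_le]
  constructor <;> by_contra! hlt <;> nlinarith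

variable {U : Type*} {X : Type*} [AddCommGroup X] [Module ℝ X] {D : Set X} {φ : X → ℝ}
  {G : U → X → ExtSpace Z}

/-- Approximate multipliers for finitely many points. -/
theorem exists_multiplier_of_fintype [Nonempty U] (hS : IsClosed (S : Set Z))
    (hne : (S : Set Z).Nonempty) (hφ : ConvexOn ℝ D φ) (hbot : ∀ u x, G u x ≠ ExtSpace.bot)
    (hG : ∀ u, IsKConvex (S : Set Z) (G u))
    (hpos : ∀ x ∈ D, (∀ u, ∃ z, -z ∈ S ∧ G u x = ExtSpace.fin z) → 0 ≤ φ x)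
    (H1 : UniformlyConcave (S : Set Z) (fun (x : D) (u : U) => G u x))
    {ι : Type*} [Fintype ι] {x : ι → X} {q : ι → ℝ} (hx : ∀ i, x i ∈ D)
    (hq : ∀ i, q i < -φ (x i)) :
    ∃ z ∈ dualCone (S : Set Z), ∃ u, ∀ i, (q i : EReal) ≤ dualComp z (G u (x i)) := by
  classical
  set A : Set (ι → ℝ) := {a | ∃ z ∈ dualCone (S : Set Z), ∃ u, ∀ i,
    (a i : EReal) ≤ dualComp z (G u (x i))} with hA
  set P : Set (ι → ℝ) := {a | ∀ i, q i < a i} with hP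
  by_contra hcon
  have hdown : ∀ a ∈ A, ∀ b, b ≤ a → b ∈ A := by
    rintro a ⟨z, hz, u, h⟩ b hb
    exact ⟨z, hz, u, fun i => (EReal.coe_le_coe_iff.2 (hb i)).trans (h i)⟩
  have hsmul : ∀ a ∈ A, ∀ t : ℝ, 0 ≤ t → t • a ∈ A := by
    rintro a ⟨z, hz, u, h⟩ t ht
    exact ⟨t • z, smul_mem_dualCone ht hz, u, fun i => le_dualComp_smul ht (h i)⟩
  have hadd : ∀ a ∈ A, ∀ b ∈ A, a + b ∈ A := by
    rintro a ⟨z₁, hz₁, u₁, h₁⟩ b ⟨z₂, hz₂, u₂, h₂⟩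
    obtain ⟨z, hz, u, h⟩ := H1 z₁ hz₁ z₂ hz₂ u₁ u₂
    refine ⟨z, hz, u, fun i => le_trans ?_ (h ⟨x i, hx i⟩)⟩
    rw [Pi.add_apply, EReal.coe_add]
    exact add_le_add (h₁ i) (h₂ i)
  have hzero : (0 : ι → ℝ) ∈ A :=
    ⟨0, zero_mem_dualCone, Classical.arbitrary U, fun i => zero_le_dualComp_zero (hbot _ _)⟩
  have hAconv : Convex ℝ A := fun a ha b hb s t hs ht _ =>
    hadd _ (hsmul a ha s hs) _ (hsmul b hb t ht)
  have hPeq : P = univ.pi fun i => Ioi (q i) := by ext a; simp [hP]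
  have hPconv : Convex ℝ P := hPeq ▸ convex_pi fun i _ => convex_Ioi (q i)
  have hPopen : IsOpen P := hPeq ▸ isOpen_set_pi finite_univ fun i _ => isOpen_Ioi
  have hdisj : Disjoint P A := by
    rw [Set.disjoint_left]
    exact fun a haP haA => hcon (hdown a haA q fun i => (haP i).le)
  obtain ⟨f, c, hfP, hfA⟩ := geometric_hahn_banach_open hPconv hPopen hAconv hdisj
  have hc : c ≤ 0 := by simpa using hfA 0 hzero
  have hfnonneg : ∀ a ∈ A, 0 ≤ f a := by
    intro a ha
    by_contra! hlt
    have ht : 0 < (c - 1) / f a := div_pos_of_neg_of_neg (by linarith) hlt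
    have h := hfA _ (hsmul a ha _ ht.le)
    rw [map_smul, smul_eq_mul, div_mul_cancel₀ _ hlt.ne] at h
    linarith
  -- Minus the coordinates of the separating functional. They are nonnegative because `A` contains
  -- the negative orthant, and after normalization they serve as convex weights.
  set lam : ι → ℝ := fun i => -f (Pi.single i 1) with hlam
  have hf : ∀ a, f a = -∑ i, lam i * a i := by
    intro a
    conv_lhs => rw [pi_eq_sum_univ' a]
    rw [map_sum, ← Finset.sum_neg_distrib]
    refine Finset.sum_congr rfl fun i _ => ?_
    rw [map_smul, smul_eq_mul]
    simp only [hlam]; ring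
  have hlam0 : ∀ i, 0 ≤ lam i := by
    intro i
    have h := hfnonneg (-Pi.single i 1) (hdown 0 hzero _ (by
      rw [neg_nonpos]; exact Pi.single_nonneg.2 zero_le_one))
    rwa [map_neg] at h
  have hneg : ∑ i, lam i * φ (x i) < 0 := by
    -- The strict inequalities `hq` put -φ(x i) in the open set `P`, which yields a strictly
    -- negative weighted sum of φ.
    have h := (hfP (fun i => -φ (x i)) hq).trans_le hc
    rw [hf] at h
    simpa [mul_neg] using h
  have hsum : 0 < ∑ i, lam i := by
    refine (Finset.sum_nonneg fun i _ => hlam0 i).lt_of_ne fun h0 => ?_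
    have hz := (Finset.sum_eq_zero_iff_of_nonneg fun i _ => hlam0 i).1 h0.symm
    rw [Finset.sum_eq_zero fun i hi => by rw [hz i hi, zero_mul]] at hneg
    exact lt_irrefl _ hneg
  set w : ι → ℝ := fun i => lam i / ∑ j, lam j with hw
  have hw0 : ∀ i, 0 ≤ w i := fun i => div_nonneg (hlam0 i) hsum.le
  have hw1 : ∑ i, w i = 1 := by rw [hw, ← Finset.sum_div, div_self hsum.ne']
  have hwsum : ∀ g : ι → ℝ, ∑ i, w i * g i = (∑ i, lam i * g i) / ∑ j, lam j := by
    intro g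
    rw [Finset.sum_div]
    exact Finset.sum_congr rfl fun i _ => by rw [hw]; ring
  have hxD : ∑ i, w i • x i ∈ D :=
    hφ.1.sum_mem (fun i _ => hw0 i) hw1 fun i _ => hx i
  refine absurd (hpos _ hxD fun u => ?_) (not_le.2 ?_)
  -- By the convention 0·(+∞) = +∞, an infinite value at x i would put the i-th unit vector in `A`
  -- with multiplier 0, forcing `lam i ≤ 0`. Thus only points of zero weight can have infinite G_u,
  -- and they are dropped from the convex combination.
  · have hfin : ∀ i, 0 < lam i → G u (x i) ≠ ExtSpace.top := by
      intro i hi htop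
      have hmem : (Pi.single i 1 : ι → ℝ) ∈ A := by
        refine ⟨0, zero_mem_dualCone, u, fun j => ?_⟩
        by_cases hj : j = i
        · subst hj
          rw [htop]; exact le_top
        · rw [Pi.single_eq_of_ne hj]
          exact zero_le_dualComp_zero (hbot _ _)
      have := hfnonneg _ hmem
      simp only [hlam] at hi
      linarith
    have hex : ∀ i, ∃ v, G u (x i) = ExtSpace.fin v ∨ G u (x i) = ExtSpace.top := by
      intro i
      have hb := hbot u (x i)
      cases h : G u (x i) with
      | bot => exact (hb h).elim
      | top => exact ⟨0, Or.inr rfl⟩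
      | fin v => exact ⟨v, Or.inl rfl⟩
    choose v hv using hex
    set t : Finset ι := Finset.univ.filter fun i => 0 < lam i with ht
    have hwt : ∀ i, i ∉ t → w i = 0 := by
      intro i hi
      have : lam i = 0 := le_antisymm (by simpa [ht] using hi) (hlam0 i)
      rw [hw]; simp [this]
    have hmem : ∑ i ∈ t, w i • (x i, v i) ∈ epi (S : Set Z) (G u) := by
      refine (hG u).sum_mem (fun i _ => hw0 i) ?_ fun i hi => ?_
      · rw [← hw1]
        exact Finset.sum_subset (Finset.subset_univ t) fun i _ hi => hwt i hi
      · refine ⟨v i, (hv i).resolve_right (hfin i (by simpa [ht] using hi)), 0,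
          zero_mem_of_isClosed_cone hS hne, (add_zero _).symm⟩
    rw [Finset.sum_subset (Finset.subset_univ t) fun i _ hi => by rw [hwt i hi, zero_smul]] at hmem
    obtain ⟨z, hz, s, hs, hzs⟩ := hmem
    simp only [Prod.smul_mk, Prod.fst_sum, Prod.snd_sum] at hz hzs
    refine ⟨z, ?_, hz⟩
    -- If the value at the averaged point were not in -S, some ζ ∈ S⁺ would be positive on it. But
    -- (ζ, u) is itself an admissible multiplier, so the separation makes the weighted sum of the
    -- ζ(v i) nonpositive, and this sum dominates ζ(z).
    by_contra hzS
    obtain ⟨ζ, hζ, hζz⟩ := exists_mem_dualCone_pos hS hne hzS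
    have hmem : (fun i => ζ (v i)) ∈ A := by
      refine ⟨ζ, hζ, u, fun i => ?_⟩
      rcases hv i with h | h
      · rw [h]; exact le_rfl
      · rw [h]; exact le_top
    have h1 := hfnonneg _ hmem
    rw [hf, neg_nonneg] at h1
    have h2 : ∑ i, w i * ζ (v i) ≤ 0 := by
      rw [hwsum]
      exact div_nonpos_of_nonpos_of_nonneg h1 hsum.le
    have h3 : ζ (∑ i, w i • v i) = ∑ i, w i * ζ (v i) := by simp [map_sum]
    rw [← h3, hzs, map_add] at h2
    linarith [hζ s hs]
  · calc φ (∑ i, w i • x i) ≤ ∑ i, w i • φ (x i) :=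
          hφ.map_sum_le (fun i _ => hw0 i) hw1 fun i _ => hx i
      _ < 0 := by
          simp only [smul_eq_mul]
          rw [hwsum]
          exact div_neg_of_neg_of_pos hneg hsum

variable [TopologicalSpace U]

theorem UniformlyUSC.isClosed_setOf_le {g : U → ExtSpace Z} (h : UniformlyUSC (S : Set Z) g)
    (q : ℝ) : IsClosed {p : WeakDual ℝ Z × U |
      p.1 ∈ dualCone (S : Set Z) ∧ (q : EReal) ≤ dualComp p.1 (g p.2)} := by
  have hcont : Continuous fun p : WeakDual ℝ Z × U => (p.1, p.2, q) :=
    continuous_fst.prodMk (continuous_snd.prodMk continuous_const)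
  exact ((uniformlyUSC_iff_isClosed _ _).1 h).preimage hcont

/-- Under a Slater condition at `u₀`, lower bounds on `z (g u)` bound `z`, locally uniformly
in `u`. -/
theorem exists_nhds_bound_of_slater {g : U → ExtSpace Z} (h : UniformlyUSC (S : Set Z) g)
    {s₀ : Z} (hs₀ : s₀ ∈ interior (S : Set Z)) {u₀ : U} {z₀ : Z}
    (hz₀ : -z₀ ∈ interior (S : Set Z)) (hg : g u₀ = ExtSpace.fin z₀) (q : ℝ) :
    ∃ V ∈ 𝓝 u₀, ∃ R : ℝ, ∀ u ∈ V, ∀ z ∈ dualCone (S : Set Z),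
      (q : EReal) ≤ dualComp z (g u) → z s₀ ≤ R := by
  -- This makes z(z₀) ≤ -ε for all z ∈ S⁺ with z(s₀) = 1. These z form a weak* compact base, so by
  -- the tube lemma z∘g stays below -ε/2 on it for u near u₀.
  obtain ⟨ε, hε, hmem⟩ := exists_add_smul_mem_interior_cone hz₀ (-s₀)
  set Θ : Set (WeakDual ℝ Z) := {z | z ∈ dualCone (S : Set Z) ∧ z s₀ = 1} with hΘ
  have hΘc : IsCompact Θ :=
    (isCompact_dualCone_le hs₀ 1).of_isClosed_subset
      ((isClosed_dualCone _).inter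
        (isClosed_eq (WeakDual.eval_continuous s₀) continuous_const))
      fun z hz => ⟨hz.1, hz.2.le⟩
  have hsub : Θ ×ˢ {u₀} ⊆ {p : WeakDual ℝ Z × U |
      p.1 ∈ dualCone (S : Set Z) ∧ ((-(ε / 2) : ℝ) : EReal) ≤ dualComp p.1 (g p.2)}ᶜ := by
    rintro ⟨z, u⟩ ⟨⟨hz, hz1⟩, rfl⟩ ⟨-, hle⟩
    rw [hg] at hle
    have hle' : -(ε / 2) ≤ z z₀ := EReal.coe_le_coe_iff.1 hle
    have h0 := hz _ (interior_subset hmem)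
    rw [smul_neg, map_add, map_neg, map_neg, map_smul, smul_eq_mul] at h0
    change z s₀ = 1 at hz1
    rw [hz1] at h0
    linarith
  obtain ⟨O, V, -, hV, hΘO, hu₀V, hOV⟩ := generalized_tube_lemma hΘc isCompact_singleton
    (h.isClosed_setOf_le (-(ε / 2))).isOpen_compl hsub
  refine ⟨V, hV.mem_nhds (hu₀V rfl), |q| / (ε / 2), fun u hu z hz hle => ?_⟩
  -- If z(s₀) > |q|/(ε/2), rescaling z to the base turns the bound q into one at least -ε/2, which
  -- the tube excludes.
  by_contra! hlt
  have hzpos : 0 < z s₀ := lt_of_le_of_lt (by positivity) hlt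
  have hzΘ : (z s₀)⁻¹ • z ∈ Θ :=
    ⟨smul_mem_dualCone (inv_pos.2 hzpos).le hz, inv_mul_cancel₀ hzpos.ne'⟩
  refine hOV (⟨hΘO hzΘ, hu⟩ : ((z s₀)⁻¹ • z, u) ∈ O ×ˢ V) ⟨hzΘ.1, ?_⟩
  refine le_trans (EReal.coe_le_coe_iff.2 ?_) (le_dualComp_smul (inv_pos.2 hzpos).le hle)
  rw [div_lt_iff₀ (by positivity)] at hlt
  rw [inv_mul_eq_div, le_div_iff₀ hzpos]
  nlinarith [neg_abs_le q]

/-- Strong duality for a scalar robust convex problem, in the form of an alternative theorem. -/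
theorem exists_robust_multiplier [CompactSpace U] [Nonempty U] (hS : IsClosed (S : Set Z))
    (hφ : ConvexOn ℝ D φ) (hbot : ∀ u x, G u x ≠ ExtSpace.bot)
    (hG : ∀ u, IsKConvex (S : Set Z) (G u))
    (hpos : ∀ x ∈ D, (∀ u, ∃ z, -z ∈ S ∧ G u x = ExtSpace.fin z) → 0 ≤ φ x)
    (H1 : UniformlyConcave (S : Set Z) (fun (x : D) (u : U) => G u x))
    (H2 : ∀ x ∈ D, UniformlyUSC (S : Set Z) (fun u => G u x))
    (C0 : ∀ u, ∃ x ∈ D, ∃ z, -z ∈ interior (S : Set Z) ∧ G u x = ExtSpace.fin z) :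
    ∃ z ∈ dualCone (S : Set Z), ∃ u, ∀ x ∈ D, ((-φ x : ℝ) : EReal) ≤ dualComp z (G u x) := by
  classical
  obtain ⟨s₀, hs₀⟩ : (interior (S : Set Z)).Nonempty := by
    obtain ⟨-, -, z, hz, -⟩ := C0 (Classical.arbitrary U)
    exact ⟨_, hz⟩
  have hne : (S : Set Z).Nonempty := ⟨s₀, interior_subset hs₀⟩
  -- The finite version needs strict lower bounds; the bound -φ(x) itself is recovered at the end as
  -- a supremum of such q.
  let ι := {p : X × ℝ // p.1 ∈ D ∧ p.2 < -φ p.1}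
  have hbound : ∃ T : Finset ι, ∃ R : ℝ, ∀ u ∈ (univ : Set U), ∀ z ∈ dualCone (S : Set Z),
      (∀ i ∈ T, (i.1.2 : EReal) ≤ dualComp z (G u i.1.1)) → z s₀ ≤ R := by
    refine isCompact_univ.induction_on (p := fun V : Set U => ∃ T : Finset ι, ∃ R : ℝ, ∀ u ∈ V,
      ∀ z ∈ dualCone (S : Set Z),
      (∀ i ∈ T, (i.1.2 : EReal) ≤ dualComp z (G u i.1.1)) → z s₀ ≤ R) ?_ ?_ ?_ ?_
    · exact ⟨∅, 0, fun u hu => hu.elim⟩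
    · rintro V W hVW ⟨T, R, h⟩
      exact ⟨T, R, fun u hu => h u (hVW hu)⟩
    · rintro V W ⟨T, R, h⟩ ⟨T', R', h'⟩
      refine ⟨T ∪ T', max R R', fun u hu z hz hle => ?_⟩
      rcases hu with hu | hu
      · exact (h u hu z hz fun i hi => hle i (Finset.mem_union_left _ hi)).trans (le_max_left _ _)
      · exact (h' u hu z hz fun i hi => hle i (Finset.mem_union_right _ hi)).trans
          (le_max_right _ _)
    · intro u₀ _
      obtain ⟨x, hx, z₀, hz₀, hg⟩ := C0 u₀
      obtain ⟨V, hV, R, hR⟩ := exists_nhds_bound_of_slater (H2 x hx) hs₀ hz₀ hg (-φ x - 1)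
      refine ⟨V, mem_nhdsWithin_of_mem_nhds hV, {⟨(x, -φ x - 1), hx, by simp⟩}, R,
        fun u hu z hz hle => hR u hu z hz (hle _ (Finset.mem_singleton_self _))⟩
  obtain ⟨T, R, hTR⟩ := hbound
  -- Each finite family is enlarged by the test family `T`, which forces its multiplier into the
  -- compact slice z(s₀) ≤ R.
  have hinter := ((isCompact_dualCone_le hs₀ R).prod (isCompact_univ (X := U))).inter_iInter_nonempty
    (fun i : ι => {p : WeakDual ℝ Z × U |
      p.1 ∈ dualCone (S : Set Z) ∧ (i.1.2 : EReal) ≤ dualComp p.1 (G p.2 i.1.1)})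
    (fun i => (H2 _ i.2.1).isClosed_setOf_le _) (fun T' => by
      obtain ⟨z, hz, u, h⟩ := exists_multiplier_of_fintype hS hne hφ hbot hG hpos H1
        (ι := (T ∪ T' : Finset ι)) (x := fun i => i.1.1.1) (q := fun i => i.1.1.2)
        (fun i => i.1.2.1) (fun i => i.1.2.2)
      refine ⟨(z, u), ⟨⟨hz, hTR u trivial z hz fun i hi =>
        h ⟨i, Finset.mem_union_left _ hi⟩⟩, trivial⟩, ?_⟩
      exact mem_iInter₂.2 fun i hi => ⟨hz, h ⟨i, Finset.mem_union_right _ hi⟩⟩)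
  obtain ⟨⟨z, u⟩, ⟨⟨hz, -⟩, -⟩, hzu⟩ := hinter
  refine ⟨z, hz, u, fun x hx => ?_⟩
  refine EReal.ge_of_forall_gt_iff_ge.1 fun q hq => ?_
  exact (mem_iInter.1 hzu ⟨(x, q), hx, EReal.coe_lt_coe_iff.1 hq⟩).2

end Multiplier

/-! ### The qualifying sets and the epigraph of the conjugate -/

section Main

variable {X : Type*} [AddCommGroup X] [Module ℝ X] [TopologicalSpace X]
  {Y : Type*} [AddCommGroup Y] [Module ℝ Y] [TopologicalSpace Y] [IsTopologicalAddGroup Y]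
  [ContinuousSMul ℝ Y]
  {Z : Type*} {U : Type*} {K : ConvexCone ℝ Y} {C : Set X} {F : X → ExtSpace Y}
  {G : U → X → ExtSpace Z}


/-- A convex set that is downward closed for the order of `K` and does not meet `int K` is
separated from `K` by a functional normalized at a given interior point. -/
theorem exists_normalized_separation {k : Y} (hk : k ∈ interior (K : Set Y)) {W : Set Y}
    (hW : Convex ℝ W) (hne : W.Nonempty) (hdown : ∀ w ∈ W, ∀ κ ∈ K, w - κ ∈ W)
    (hdisj : ∀ w ∈ W, w ∉ interior (K : Set Y)) :
    ∃ f : Y →L[ℝ] ℝ, f k = 1 ∧ (∀ κ ∈ K, 0 ≤ f κ) ∧ ∀ w ∈ W, f w ≤ 0 := by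
  obtain ⟨f, c, hfK, hfW⟩ := geometric_hahn_banach_open K.convex.interior isOpen_interior hW
    (Set.disjoint_left.2 fun w hwK hwW => hdisj w hwW hwK)
  obtain ⟨w₀, hw₀⟩ := hne
  have hK : ∀ κ ∈ interior (K : Set Y), f κ ≤ 0 := by
    intro κ hκ
    by_contra! hlt
    have h := hfK _ (smul_mem_interior_cone (div_pos (hlt.trans (hfK κ hκ)) hlt) hκ)
    rw [map_smul, smul_eq_mul, div_mul_cancel₀ _ hlt.ne'] at h
    exact lt_irrefl _ h
  have hc : 0 ≤ c := by
    by_contra! hlt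
    have hfk : f k < 0 := (hfK k hk).trans hlt
    have h := hfK _ (smul_mem_interior_cone (div_pos_of_neg_of_neg hlt hfk) hk)
    rw [map_smul, smul_eq_mul, div_mul_cancel₀ _ hfk.ne] at h
    exact lt_irrefl _ h
  have hfk : f k < 0 := by
    refine (hK k hk).lt_of_ne fun h0 => ?_
    obtain ⟨ε, hε, hmem⟩ := exists_add_smul_mem_interior_cone hk w₀
    have h := hK _ hmem
    rw [map_add, map_smul, smul_eq_mul, h0, zero_add] at h
    have h1 := hfK k hk
    have h2 := mul_pos hε ((h0 ▸ h1).trans_le (hfW w₀ hw₀))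
    linarith
  -- Hahn–Banach delivers f negative at k; dividing by f(k) normalizes and reverses all signs at
  -- once.
  have hinv : (f k)⁻¹ ≤ 0 := (inv_lt_zero.2 hfk).le
  refine ⟨(f k)⁻¹ • f, inv_mul_cancel₀ hfk.ne, fun κ hκ => ?_, fun w hw => ?_⟩
  · refine mul_nonneg_of_nonpos_of_nonpos hinv ?_
    change f κ ≤ 0
    by_contra! hlt
    have h0 := hfW w₀ hw₀
    have h := hfW _ (hdown w₀ hw₀ _ (K.smul_mem
      (div_pos (by linarith : 0 < f w₀ - c + 1) hlt) hκ))
    rw [map_sub, map_smul, smul_eq_mul, div_mul_cancel₀ _ hlt.ne'] at h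
    linarith
  · exact mul_nonpos_of_nonpos_of_nonneg hinv (hc.trans (hfW w hw))

section

variable [NormedAddCommGroup Z] [NormedSpace ℝ Z] {S : ConvexCone ℝ Z}

variable [TopologicalSpace U] [CompactSpace U] [Nonempty U]

/-- Existence of a robust multiplier for every point of the epigraph of the conjugate. -/
theorem epiConj_add_indMap_feasible_subset_setAk
    (hK_closed : IsClosed (K : Set Y)) {k : Y} (hk : k ∈ interior (K : Set Y))
    (hS_closed : IsClosed (S : Set Z))
    (hF_proper : IsProper F) (hG_proper : ∀ u, IsProper (G u))
    (hfeas : (feasible (S : Set Z) C G ∩ effDom F).Nonempty)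
    (hC_convex : Convex ℝ C) (hF_convex : IsKConvex (K : Set Y) F)
    (hG_convex : ∀ u, IsKConvex (S : Set Z) (G u))
    (H1 : UniformlyConcave (S : Set Z)
      (fun (x : (C ∩ effDom F : Set X)) (u : U) => G u x))
    (H2 : ∀ x ∈ C ∩ effDom F, UniformlyUSC (S : Set Z) (fun u => G u x))
    (C0 : ∀ u, ∃ x ∈ C ∩ effDom F, ∃ z ∈ -interior (S : Set Z), G u x = ExtSpace.fin z) :
    epiConj (K : Set Y) (fun x => F x + indMap (feasible (S : Set Z) C G) x) ⊆
      setAk (K : Set Y) (S : Set Z) C F G k := by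
  intro p hp
  rw [mem_epiConj_add_indMap_feasible_iff hK_closed ⟨k, hk⟩ hF_proper hfeas] at hp
  have hK0 : (0 : Y) ∈ K := zero_mem_of_isClosed_cone hK_closed ⟨k, interior_subset hk⟩
  have hA := convex_feasible hC_convex hG_convex
  -- Using the whole epigraph instead of the values of F makes `W` convex and downward closed.
  let W : Set Y := {w | ∃ x ∈ feasible (S : Set Z) C G, ∃ e, (x, e) ∈ epi (K : Set Y) F ∧
    w = p.1 x - e - p.2}
  have hgraph : ∀ {x a}, F x = ExtSpace.fin a → (x, a) ∈ epi (K : Set Y) F :=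
    fun {x a} ha => ⟨a, ha, 0, hK0, (add_zero a).symm⟩
  obtain ⟨f, hfk, hfK, hfW⟩ := exists_normalized_separation hk (W := W) (by
      rintro _ ⟨x, hx, e, he, rfl⟩ _ ⟨x', hx', e', he', rfl⟩ a b ha hb hab
      refine ⟨_, hA hx hx' ha hb hab, a • e + b • e', hF_convex he he' ha hb hab, ?_⟩
      rw [map_add, map_smul, map_smul]
      have hb' : b = 1 - a := by linarith
      subst hb'
      module) (by
      obtain ⟨x, hx, hxF⟩ := hfeas
      obtain ⟨a, ha⟩ := hF_proper.exists_eq_fin hxF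
      exact ⟨_, x, hx, a, hgraph ha, rfl⟩) (by
      rintro _ ⟨x, hx, e, ⟨a, ha, κ', hκ', he⟩, rfl⟩ κ hκ
      refine ⟨x, hx, e + κ, ⟨a, ha, κ' + κ, K.add_mem hκ' hκ, ?_⟩, by abel⟩
      change e = a + κ' at he
      change e + κ = _
      rw [he, add_assoc]) (by
      rintro _ ⟨x, hx, e, ⟨a, ha, κ, hκ, he⟩, rfl⟩ hmem
      change e = a + κ at he
      refine hp x hx a ha ?_
      have h := add_mem_interior_cone hmem hκ
      rw [he] at h
      convert h using 1
      abel)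
  have hex : ∀ x, ∃ a, x ∈ effDom F → F x = ExtSpace.fin a := by
    intro x
    by_cases hx : x ∈ effDom F
    · obtain ⟨a, ha⟩ := hF_proper.exists_eq_fin hx
      exact ⟨a, fun _ => ha⟩
    · exact ⟨0, fun h => (hx h).elim⟩
  choose g hg using hex
  have hφ : ConvexOn ℝ (C ∩ effDom F) fun x => f (g x - p.1 x + p.2) := by
    have key : ∀ x ∈ C ∩ effDom F, ∀ y ∈ C ∩ effDom F, ∀ a b : ℝ, 0 ≤ a → 0 ≤ b → a + b = 1 →
        ∃ c, F (a • x + b • y) = ExtSpace.fin c ∧ ∃ κ ∈ K, a • g x + b • g y = c + κ := by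
      intro x hx y hy a b ha hb hab
      exact hF_convex (hgraph (hg x hx.2)) (hgraph (hg y hy.2)) ha hb hab
    refine ⟨fun x hx y hy a b ha hb hab => ?_, fun x hx y hy a b ha hb hab => ?_⟩
    · obtain ⟨c, hc, -⟩ := key x hx y hy a b ha hb hab
      exact ⟨hC_convex hx.1 hy.1 ha hb hab, mem_effDom_of_eq_fin hc⟩
    · obtain ⟨c, hc, κ, hκ, hsum⟩ := key x hx y hy a b ha hb hab
      have hcg : g (a • x + b • y) = c := by
        have h := hg _ (mem_effDom_of_eq_fin hc)
        rw [hc] at h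
        exact (ExtSpace.fin.inj h).symm
      have h1 := congrArg f hsum
      simp only [map_add, map_sub, map_smul, smul_eq_mul, hcg] at h1 ⊢
      have h2 := hfK κ hκ
      have hb' : b = 1 - a := by linarith
      subst hb'
      linarith
  obtain ⟨z, hz, u, hzu⟩ := exists_robust_multiplier hS_closed hφ (fun u => (hG_proper u).2)
    hG_convex (by
      intro x hx hGx
      have h := hfW _ ⟨x, mem_feasible_iff.2 ⟨hx.1, hGx⟩, g x, hgraph (hg x hx.2), rfl⟩
      simp only [map_add, map_sub] at h ⊢
      linarith) H1 H2 (by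
      intro u
      obtain ⟨x, hx, z, hz, hzx⟩ := C0 u
      exact ⟨x, hx, z, hz, hzx⟩)
  refine mem_iUnion₂.2 ⟨z, hz, mem_iUnion.2 ⟨u, ?_⟩⟩
  rw [mem_epiConj_add_opComp_iff hK_closed ⟨k, hk⟩ hF_proper hG_proper hfeas]
  intro x hx a v ha hv hmem
  have hxF := mem_effDom_of_eq_fin ha
  have hga : g x = a := by
    have h := hg x hxF
    rw [ha] at h
    exact (ExtSpace.fin.inj h).symm
  have h := hzu x ⟨hx, hxF⟩
  rw [hv] at h
  have h1 : -f (g x - p.1 x + p.2) ≤ z v := EReal.coe_le_coe_iff.1 h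
  -- f is only known to be nonnegative on K; the margin ε•k with f(k) = 1 supplies the strict
  -- inequality.
  obtain ⟨ε, hε, hεmem⟩ := exists_add_smul_mem_interior_cone hmem (-k)
  have h2 := hfK _ (interior_subset hεmem)
  rw [hga] at h1
  simp only [rankOne_apply, map_add, map_sub, map_smul, map_neg, smul_eq_mul, hfk] at h1 h2
  linarith

end

variable [AddCommGroup Z] [Module ℝ Z] [TopologicalSpace Z] {S : ConvexCone ℝ Z}

theorem setAk_subset_setA (hK0 : (0 : Y) ∈ K) {k : Y} (hk : k ∈ K) :
    setAk (K : Set Y) (S : Set Z) C F G k ⊆ setA (K : Set Y) (S : Set Z) C F G := by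
  intro p hp
  obtain ⟨z, hz, hp⟩ := mem_iUnion₂.1 hp
  refine mem_iUnion₂.2 ⟨rankOne k z, ?_, hp⟩
  rintro _ ⟨s, hs, rfl⟩
  rw [rankOne_apply]
  rcases (hz s hs).eq_or_lt with h | h
  · rw [← h, zero_smul]; exact hK0
  · exact K.smul_mem h hk

/-- For positive T the values T(-S) lie in -K, so every finite v in their weak supremum has -v ∈ K.
Translation by (0, v) then only enlarges the epigraph, and the same pair (T, u) works. -/
theorem setA_subset_setB [Nonempty U] (hK_closed : IsClosed (K : Set Y))
    (hK_int : (interior (K : Set Y)).Nonempty) (hK_ne : (K : Set Y) ≠ univ)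
    (hF_proper : IsProper F) (hG_proper : ∀ u, IsProper (G u))
    (hfeas : (feasible (S : Set Z) C G ∩ effDom F).Nonempty) :
    setA (K : Set Y) (S : Set Z) C F G ⊆ setB (K : Set Y) (S : Set Z) C F G := by
  intro p hp
  obtain ⟨T, hT, hp⟩ := mem_iUnion₂.1 hp
  obtain ⟨u, hp⟩ := mem_iUnion.1 hp
  rw [mem_epiConj_add_opComp_iff hK_closed hK_int hF_proper hG_proper hfeas] at hp
  refine mem_iUnion₂.2 ⟨T, ?_, mem_iUnion.2 ⟨u, mem_iInter₂.2 fun v hv => ?_⟩⟩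
  · refine eq_empty_iff_forall_notMem.2 fun y ⟨hyT, hy⟩ => zero_notMem_interior_cone hK_ne ?_
    have := add_mem_interior_cone hy (hT hyT)
    rwa [neg_add_cancel] at this
  · obtain ⟨k, hk⟩ := hK_int
    have hvK : -v ∈ K := by
      have hlim : Tendsto (fun t : ℝ => -v + t • k) (𝓝[>] 0) (𝓝 (-v)) := by
        have : Continuous fun t : ℝ => -v + t • k := by fun_prop
        simpa using (this.tendsto 0).mono_left nhdsWithin_le_nhds
      refine hK_closed.mem_of_tendsto hlim (eventually_nhdsWithin_of_forall fun t ht => ?_)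
      -- v - t•k is strictly below v, so some T(z) with z ∈ -S exceeds it. Adding T(-z) ∈ K gives -v
      -- + t•k ∈ int K, and t → 0 finishes.
      obtain ⟨_, ⟨z, rfl⟩, hlt⟩ := hv.2 (ExtSpace.fin (v - t • k)) (by
        change -(v - t • k - v) ∈ interior (K : Set Y)
        convert smul_mem_interior_cone ht hk using 1
        abel)
      cases h : ExtSpace.fin (T z) + -indMap (-(S : Set Z)) z with
      | bot => simp only [h] at hlt; exact hlt.elim
      | top => exact (indMap_ne_bot (ExtSpace.fin_add_neg_eq_top_iff.1 h)).elim
      | fin w =>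
        simp only [h] at hlt
        obtain ⟨w', hw', rfl⟩ := ExtSpace.fin_add_neg_eq_fin_iff.1 h
        obtain ⟨hz, rfl⟩ := indMap_eq_fin_iff.1 hw'
        have hmem : -(v - t • k - (T z - 0)) ∈ interior (K : Set Y) := hlt
        have hTz : T (-z) ∈ K := hT ⟨-z, hz, rfl⟩
        have := interior_subset (add_mem_interior_cone hmem hTz)
        rw [map_neg] at this
        convert this using 1
        abel
    refine ⟨(p.1, p.2 - v), ?_, Prod.ext (add_zero _) (sub_add_cancel _ _)⟩
    rw [mem_epiConj_add_opComp_iff hK_closed ⟨k, hk⟩ hF_proper hG_proper hfeas]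
    intro x hx a z ha hz hmem
    refine hp x hx a z ha hz ?_
    have : p.1 x - (a + T z) - (p.2 - v) + -v ∈ interior (K : Set Y) :=
      add_mem_interior_cone hmem hvK
    convert this using 1
    abel

/-- At a feasible x with z = G_u(x) ∈ -S, the translation is tested at v = T(z) + t•k in the weak
supremum of T(-S), with t ≥ 0. This v absorbs the term T(z). -/
theorem setB_subset_epiConj [Nonempty U] (hK_closed : IsClosed (K : Set Y))
    (hK_int : (interior (K : Set Y)).Nonempty)
    (hF_proper : IsProper F) (hG_proper : ∀ u, IsProper (G u))
    (hfeas : (feasible (S : Set Z) C G ∩ effDom F).Nonempty) :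
    setB (K : Set Y) (S : Set Z) C F G ⊆
      epiConj (K : Set Y) (fun x => F x + indMap (feasible (S : Set Z) C G) x) := by
  intro p hp
  obtain ⟨T, hT, hp⟩ := mem_iUnion₂.1 hp
  obtain ⟨u, hp⟩ := mem_iUnion.1 hp
  rw [mem_epiConj_add_indMap_feasible_iff hK_closed hK_int hF_proper hfeas]
  intro x hx a ha hmem
  obtain ⟨hC, hG⟩ := mem_feasible_iff.1 hx
  obtain ⟨z, hz, hzx⟩ := hG u
  obtain ⟨k, hk⟩ := hK_int
  set M : Set (ExtSpace Y) := range fun z => ExtSpace.fin (T z) + -indMap (-(S : Set Z)) z with hM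
  have hmemM : ∀ y, ExtSpace.fin y ∈ M ↔ ∃ z, -z ∈ S ∧ T z = y := by
    intro y
    constructor
    · rintro ⟨z, h⟩
      obtain ⟨w, hw, rfl⟩ := ExtSpace.fin_add_neg_eq_fin_iff.1 h
      obtain ⟨hz, rfl⟩ := indMap_eq_fin_iff.1 hw
      exact ⟨z, hz, (sub_zero _).symm⟩
    · rintro ⟨z, hz, rfl⟩
      exact ⟨z, ExtSpace.fin_add_neg_eq_fin_iff.2 ⟨0, indMap_eq_fin_iff.2 ⟨hz, rfl⟩,
        (sub_zero _).symm⟩⟩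
  obtain ⟨ε, hε, hεmem⟩ := exists_add_smul_mem_interior_cone hk (T z)
  have hzM : ExtSpace.fin (T z) ∈ M := (hmemM _).2 ⟨z, hz, rfl⟩
  obtain ⟨t, ht, -⟩ := exists_fin_mem_wsup hk (M := M) (y₀ := T z) (m₀ := T z)
    (by rintro ⟨z, h⟩; exact indMap_ne_bot (ExtSpace.fin_add_neg_eq_top_iff.1 h)) hzM
    -- Boundedness along the ray is where weak positivity enters: T(z) + ε⁻¹•k ∈ int K, so a T(z')
    -- strictly above it would itself lie in int K, although -z' ∈ S.
    ⟨ε⁻¹, fun v hv hvmem => by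
      obtain ⟨z', hz', rfl⟩ := (hmemM v).1 hv
      have h1 := smul_mem_interior_cone (inv_pos.2 hε) hεmem
      rw [smul_add, inv_smul_smul₀ hε.ne'] at h1
      have h2 := add_mem_interior_cone hvmem (interior_subset h1)
      have h3 : T (-z') ∈ T '' (S : Set Z) ∩ -interior (K : Set Y) := by
        refine ⟨⟨_, hz', rfl⟩, ?_⟩
        change -T (-z') ∈ interior (K : Set Y)
        rw [map_neg, neg_neg]
        convert h2 using 1
        abel
      rw [show T '' (S : Set Z) ∩ -interior (K : Set Y) = ∅ from hT] at h3
      exact h3⟩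
  have ht0 : 0 ≤ t := by
    by_contra! hlt
    refine ht.1 _ hzM ?_
    change -(T z + t • k - T z) ∈ interior (K : Set Y)
    rw [add_sub_cancel_left, ← neg_smul]
    exact smul_mem_interior_cone (neg_pos.2 hlt) hk
  obtain ⟨p', hp', hpp⟩ := mem_iInter₂.1 hp _ ht
  rw [mem_epiConj_add_opComp_iff hK_closed ⟨k, hk⟩ hF_proper hG_proper hfeas] at hp'
  refine hp' x hC a z ha hzx ?_
  have e1 : p'.1 = p.1 := by rw [← hpp]; exact (add_zero _).symm
  have e2 : p.2 = p'.2 + (T z + t • k) := by rw [← hpp]; rfl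
  rw [e2] at hmem
  have h := smul_add_mem_interior_cone_of_le hk (s := 0) ht0 (by simpa using hmem)
  rw [e1]
  convert h using 1
  abel

end Main

end RobustVO

theorem proposition5p3
    {X : Type*} [AddCommGroup X] [Module ℝ X] [TopologicalSpace X] [IsTopologicalAddGroup X]
    [ContinuousSMul ℝ X] [LocallyConvexSpace ℝ X] [T2Space X]
    {Y : Type*} [AddCommGroup Y] [Module ℝ Y] [TopologicalSpace Y] [IsTopologicalAddGroup Y]
    [ContinuousSMul ℝ Y] [LocallyConvexSpace ℝ Y] [T2Space Y]
    {Z : Type*} [NormedAddCommGroup Z] [NormedSpace ℝ Z]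
    {U : Type*} [TopologicalSpace U] [CompactSpace U] [Nonempty U]
    -- the ordering cones
    (K : ConvexCone ℝ Y) (hK_closed : IsClosed (K : Set Y))
    (hK_int : (interior (K : Set Y)).Nonempty) (hK_ne : (K : Set Y) ≠ Set.univ)
    (S : ConvexCone ℝ Z) (hS_closed : IsClosed (S : Set Z)) (hS_ne : (S : Set Z).Nonempty)
    -- the data of the robust problem
    (C : Set X) (F : X → ExtSpace Y) (G : U → X → ExtSpace Z)
    (hF_proper : IsProper F) (hG_proper : ∀ u, IsProper (G u))
    (hfeas : (feasible (S : Set Z) C G ∩ effDom F).Nonempty)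
    -- convexity hypothesis (H0)
    (hC_ne : C.Nonempty) (hC_closed : IsClosed C) (hC_convex : Convex ℝ C)
    (hF_convex : IsKConvex (K : Set Y) F) (hF_lsc : IsPositivelyLSC (K : Set Y) F)
    (hG_convex : ∀ u, IsKConvex (S : Set Z) (G u))
    (hG_closed : ∀ u, IsKEpiClosed (S : Set Z) (G u))
    -- uniform concavity (H1)
    (H1 : UniformlyConcave (S : Set Z)
      (fun (x : (C ∩ effDom F : Set X)) (u : U) => G u x))
    -- uniform upper semicontinuity (H2)
    (H2 : ∀ x ∈ C ∩ effDom F, UniformlyUSC (S : Set Z) (fun u => G u x))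
    -- Slater-type condition (C0)
    (C0 : ∀ u, ∃ x ∈ C ∩ effDom F, ∃ z ∈ -interior (S : Set Z), G u x = ExtSpace.fin z) :
    ∀ k ∈ interior (K : Set Y),
      (KSectionallyConvex k (setAk (K : Set Y) (S : Set Z) C F G k) ∧
        IsClosed (setAk (K : Set Y) (S : Set Z) C F G k)) ∧
      (KSectionallyConvex k (setA (K : Set Y) (S : Set Z) C F G) ∧
        IsClosed (setA (K : Set Y) (S : Set Z) C F G)) ∧
      (KSectionallyConvex k (setB (K : Set Y) (S : Set Z) C F G) ∧
        IsClosed (setB (K : Set Y) (S : Set Z) C F G)) ∧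
      setAk (K : Set Y) (S : Set Z) C F G k =
        epiConj (K : Set Y) (fun x => F x + indMap (feasible (S : Set Z) C G) x) ∧
      setA (K : Set Y) (S : Set Z) C F G =
        epiConj (K : Set Y) (fun x => F x + indMap (feasible (S : Set Z) C G) x) ∧
      setB (K : Set Y) (S : Set Z) C F G =
        epiConj (K : Set Y) (fun x => F x + indMap (feasible (S : Set Z) C G) x) := by
  intro k hk
  have h0 : (0 : Y) ∈ K := zero_mem_of_isClosed_cone hK_closed ⟨k, interior_subset hk⟩
  have h1 := setAk_subset_setA (S := S) (C := C) (F := F) (G := G) h0 (interior_subset hk)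
  have h2 := setA_subset_setB hK_closed hK_int hK_ne hF_proper hG_proper hfeas
  have h3 := setB_subset_epiConj hK_closed hK_int hF_proper hG_proper hfeas
  have h4 := epiConj_add_indMap_feasible_subset_setAk hK_closed hk hS_closed hF_proper hG_proper
    hfeas hC_convex hF_convex hG_convex H1 H2 C0
  have eB := h3.antisymm (h4.trans (h1.trans h2))
  have eA := (h2.trans h3).antisymm (h4.trans h1)
  have eAk := (h1.trans (h2.trans h3)).antisymm h4
  have hbot : ∀ x, F x + indMap (feasible (S : Set Z) C G) x ≠ ExtSpace.bot :=
    fun x => ExtSpace.add_ne_bot (hF_proper.2 x) indMap_ne_bot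
  have hdom : ∃ x v, F x + indMap (feasible (S : Set Z) C G) x = ExtSpace.fin v := by
    obtain ⟨x, hx, hxF⟩ := hfeas
    obtain ⟨a, ha⟩ := hF_proper.exists_eq_fin hxF
    exact ⟨x, a, add_indMap_eq_fin_iff.2 ⟨ha, hx⟩⟩
  have hconv := kSectionallyConvex_epiConj hK_closed hk hbot hdom
  have hclosed := isClosed_epiConj hK_closed hK_int hbot hdom
  rw [eB, eA, eAk]
  exact ⟨⟨hconv, hclosed⟩, ⟨hconv, hclosed⟩, ⟨hconv, hclosed⟩, rfl, rfl, rfl⟩
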